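/- Let $G$ be a compact (Hausdorff) abelian group with Pontryagin dual $\widehat G$ (the continuous homomorphisms $G\to\mathbb T$), and let $(A,G,\alpha)$ and $(B,G,\beta)$ be $C^*$-dynamical systems, i.e. $\alpha:G\to\mathrm{Aut}(A)$ and $\beta:G\to\mathrm{Aut}(B)$ are strongly continuous homomorphisms into the $*$-automorphism groups of the (not necessarily unital) $C^*$-algebras $A$ and $B$. Let $A\otimes B$ be the minimal (spatial) tensor product, let $\lambda$ be the action of $G$ on $A\otimes B$ characterized by $\lambda_s(a\otimes b)=\alpha_s(a)\otimes\beta_{s^{-1}}(b)$, and let the $G$-balanced tensor product $A\otimes_G B:=(A\otimes B)^\lambda$ be its fixed point algebra. For $\chi\in\widehat G$ put $$A_\chi=\{a\in A:\alpha_s(a)=\chi(s)a\ \text{for all } s\in G\},\qquad B_\chi=\{b\in B:\beta_s(b)=\chi(s)b\ \text{for all } s\in G\}.$$ Then $\{A_\chi\}_{\chi\in\widehat G}$ and $\{B_\chi\}_{\chi\in\widehat G}$ are $\widehat G$-gradings of $A$ and $B$, that is, linearly independent families of closed subspaces with $A_\chi A_\psi\subseteq A_{\chi\psi}$, $A_\chi^*=A_{\chi^{-1}}$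 and $A=\overline{\mathrm{span}}\bigcup_\chi A_\chi$, and likewise for $B$. Moreover, with $$S_\chi=\{a\otimes b: a\in A_\chi,\ b\in B_\chi\},\qquad S=\bigcup_{\chi\in\widehat G}S_\chi,$$ one has $$A\otimes_G B=\overline{\mathrm{span}}(S).$$ -/

import Mathlib

open scoped TensorProduct ENNReal

universe u v

/-! ## Representations and the minimal (spatial) tensor product -/

/-- A Hilbert space, bundled with its structure. -/
structure HilbertSpc : Type (u + 1) where
  carrier : Type u
  [normed : NormedAddCommGroup carrier]
  [inner : InnerProductSpace ℂ carrier]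
  [complete : CompleteSpace carrier]

attribute [instance] HilbertSpc.normed HilbertSpc.inner HilbertSpc.complete

/-- A representation of a C⋆-algebra `A` by bounded operators on a Hilbert space `H`. -/
structure CStarRep (A : Type u) [NonUnitalCStarAlgebra A] : Type (u + 1) where
  H : HilbertSpc.{u}
  hom : A →⋆ₙₐ[ℂ] (H.carrier →L[ℂ] H.carrier)

/-- The pull-back of a representation along a ⋆-homomorphism. -/
noncomputable def CStarRep.comp {A A' : Type u} [NonUnitalCStarAlgebra A]
    [NonUnitalCStarAlgebra A'] (π : CStarRep A') (φ : A →⋆ₙₐ[ℂ] A') : CStarRep A where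
  H := π.H
  hom := π.hom.comp φ

/-- The Hilbert space tensor product: the completion of the algebraic tensor product for the
inner product `⟪x ⊗ y, x' ⊗ y'⟫ = ⟪x, x'⟫ * ⟪y, y'⟫`. -/
abbrev HilbertTensor (H : Type u) (K : Type v) [NormedAddCommGroup H] [InnerProductSpace ℂ H]
    [NormedAddCommGroup K] [InnerProductSpace ℂ K] : Type (max u v) :=
  UniformSpace.Completion (H ⊗[ℂ] K)

section OpTensor

variable {H : Type u} {K : Type v} [NormedAddCommGroup H] [InnerProductSpace ℂ H]
  [NormedAddCommGroup K] [InnerProductSpace ℂ K]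

/-- The bounded operator `S ⊗ T` on the Hilbert space tensor product, with
`(S ⊗ T) (x ⊗ y) = S x ⊗ T y`. -/
noncomputable def opTensor (S : H →L[ℂ] H) (T : K →L[ℂ] K) :
    HilbertTensor H K →L[ℂ] HilbertTensor H K :=
  (TensorProduct.mapL S T).completion

theorem opTensor_coe_tmul (S : H →L[ℂ] H) (T : K →L[ℂ] K) (x : H) (y : K) :
    opTensor S T ((x ⊗ₜ[ℂ] y : H ⊗[ℂ] K) : HilbertTensor H K) =
      ((S x ⊗ₜ[ℂ] T y : H ⊗[ℂ] K) : HilbertTensor H K) := by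
  simp [opTensor]

theorem norm_opTensor_le (S : H →L[ℂ] H) (T : K →L[ℂ] K) :
    ‖opTensor S T‖ ≤ ‖S‖ * ‖T‖ := by
  refine ContinuousLinearMap.opNorm_le_bound _ (by positivity) fun x => ?_
  induction x using UniformSpace.Completion.induction_on with
  | hp =>
    exact isClosed_le (opTensor S T).continuous.norm (continuous_const.mul continuous_norm)
  | ih x =>
    rw [opTensor, ContinuousLinearMap.completion_apply_coe, UniformSpace.Completion.norm_coe,
      UniformSpace.Completion.norm_coe]
    exact ((TensorProduct.mapL S T).le_opNorm x).trans
      (mul_le_mul_of_nonneg_right (TensorProduct.norm_mapL_le S T) (norm_nonneg x))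

theorem opTensor_add_left (S S' : H →L[ℂ] H) (T : K →L[ℂ] K) :
    opTensor (S + S') T = opTensor S T + opTensor S' T := by
  ext x
  induction x using UniformSpace.Completion.induction_on with
  | hp => exact isClosed_eq (by fun_prop) (by fun_prop)
  | ih x => simp [opTensor, TensorProduct.map_add_left, UniformSpace.Completion.coe_add]

theorem opTensor_add_right (S : H →L[ℂ] H) (T T' : K →L[ℂ] K) :
    opTensor S (T + T') = opTensor S T + opTensor S T' := by
  ext x
  induction x using UniformSpace.Completion.induction_on with
  | hp => exact isClosed_eq (by fun_prop) (by fun_prop)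
  | ih x => simp [opTensor, TensorProduct.map_add_right, UniformSpace.Completion.coe_add]

theorem opTensor_smul_left (c : ℂ) (S : H →L[ℂ] H) (T : K →L[ℂ] K) :
    opTensor (c • S) T = c • opTensor S T := by
  ext x
  induction x using UniformSpace.Completion.induction_on with
  | hp => exact isClosed_eq (opTensor (c • S) T).continuous (c • opTensor S T).continuous
  | ih x => simp [opTensor, TensorProduct.map_smul_left, UniformSpace.Completion.coe_smul]

theorem opTensor_smul_right (c : ℂ) (S : H →L[ℂ] H) (T : K →L[ℂ] K) :
    opTensor S (c • T) = c • opTensor S T := by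
  ext x
  induction x using UniformSpace.Completion.induction_on with
  | hp => exact isClosed_eq (opTensor S (c • T)).continuous (c • opTensor S T).continuous
  | ih x => simp [opTensor, TensorProduct.map_smul_right, UniformSpace.Completion.coe_smul]

end OpTensor

/-- The C⋆-algebra of bounded operators on the Hilbert space tensor product of `H` and `K`. -/
def TensorOp (H : HilbertSpc.{u}) (K : HilbertSpc.{v}) : Type (max u v) :=
  HilbertTensor H.carrier K.carrier →L[ℂ] HilbertTensor H.carrier K.carrier

noncomputable instance (H : HilbertSpc.{u}) (K : HilbertSpc.{v}) : CStarAlgebra (TensorOp H K) :=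
  inferInstanceAs
    (CStarAlgebra (HilbertTensor H.carrier K.carrier →L[ℂ] HilbertTensor H.carrier K.carrier))

section MinTensor

variable (A : Type u) (B : Type v) [NonUnitalCStarAlgebra A] [NonUnitalCStarAlgebra B]

/-- The C⋆-algebra of bounded families of operators, indexed by all pairs `(π, ρ)` of a
representation of `A` and a representation of `B`, with the supremum norm. The `(π, ρ)` entry is an
operator on the Hilbert space tensor product of the spaces of `π` and `ρ`. -/
abbrev PairFamily : Type (max (u + 1) (v + 1)) :=
  lp (fun p : CStarRep A × CStarRep B => TensorOp p.1.H p.2.H) ∞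

variable {A B}

theorem norm_pair_le (a : A) (b : B) (p : CStarRep A × CStarRep B) :
    ‖opTensor (p.1.hom a) (p.2.hom b)‖ ≤ ‖a‖ * ‖b‖ :=
  (norm_opTensor_le _ _).trans (mul_le_mul (NonUnitalStarAlgHom.norm_apply_le p.1.hom a)
    (NonUnitalStarAlgHom.norm_apply_le p.2.hom b) (norm_nonneg _) (norm_nonneg _))

/-- The family `(π a ⊗ ρ b)` over all pairs `(π, ρ)`. -/
noncomputable def pairTmul (a : A) (b : B) : PairFamily A B :=
  ⟨fun p => opTensor (p.1.hom a) (p.2.hom b), memℓp_infty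
    ⟨‖a‖ * ‖b‖, by rintro _ ⟨p, rfl⟩; exact norm_pair_le a b p⟩⟩

variable (A B)

/-- The closed ⋆-subalgebra generated by the elementary tensors. -/
noncomputable def minTensorSubalgebra : NonUnitalStarSubalgebra ℂ (PairFamily A B) :=
  (NonUnitalStarAlgebra.adjoin ℂ
    (Set.range fun p : A × B => pairTmul p.1 p.2)).topologicalClosure

/-- The minimal (spatial) tensor product of two C⋆-algebras: the completion of the image of the
algebraic tensor product for the norm `‖x‖ = sup ‖(π ⊗ ρ) x‖` over all pairs of representations
`π` of `A` and `ρ` of `B`. -/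
def MinTensor : Type (max (u + 1) (v + 1)) := ↥(minTensorSubalgebra A B)

theorem isClosed_minTensorSubalgebra : IsClosed (minTensorSubalgebra A B : Set (PairFamily A B)) :=
  NonUnitalStarSubalgebra.isClosed_topologicalClosure _

noncomputable instance : NonUnitalCStarAlgebra (MinTensor A B) :=
  NonUnitalStarSubalgebra.nonUnitalCStarAlgebra (minTensorSubalgebra A B)
    (h_closed := isClosed_minTensorSubalgebra A B)

variable {A B}

theorem pairTmul_apply (a : A) (b : B) (p : CStarRep A × CStarRep B) :
    pairTmul a b p = opTensor (p.1.hom a) (p.2.hom b) := rfl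

/-- The elementary tensor `a ⊗ b` in the minimal tensor product. -/
noncomputable def MinTensor.tmul (a : A) (b : B) : MinTensor A B :=
  ⟨pairTmul a b, NonUnitalStarSubalgebra.le_topologicalClosure _
    (NonUnitalStarAlgebra.subset_adjoin ℂ _ ⟨(a, b), rfl⟩)⟩

namespace MinTensor

theorem coe_tmul (a : A) (b : B) : (tmul a b : MinTensor A B).1 = pairTmul a b := rfl

theorem norm_tmul_le (a : A) (b : B) : ‖tmul a b‖ ≤ ‖a‖ * ‖b‖ :=
  lp.norm_le_of_forall_le (f := pairTmul a b) (by positivity) fun p => norm_pair_le a b p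

theorem tmul_add_left (a a' : A) (b : B) : tmul (a + a') b = tmul a b + tmul a' b :=
  Subtype.ext (Subtype.ext (funext fun p =>
    (congrArg (fun S => opTensor S (p.2.hom b)) (map_add p.1.hom a a')).trans
      (opTensor_add_left _ _ _)))

theorem tmul_add_right (a : A) (b b' : B) : tmul a (b + b') = tmul a b + tmul a b' :=
  Subtype.ext (Subtype.ext (funext fun p =>
    (congrArg (fun S => opTensor (p.1.hom a) S) (map_add p.2.hom b b')).trans
      (opTensor_add_right _ _ _)))

theorem tmul_smul_left (c : ℂ) (a : A) (b : B) : tmul (c • a) b = c • tmul a b :=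
  Subtype.ext (Subtype.ext (funext fun p =>
    (congrArg (fun S => opTensor S (p.2.hom b)) (map_smul p.1.hom c a)).trans
      (opTensor_smul_left _ _ _)))

theorem tmul_smul_right (c : ℂ) (a : A) (b : B) : tmul a (c • b) = c • tmul a b :=
  Subtype.ext (Subtype.ext (funext fun p =>
    (congrArg (fun S => opTensor (p.1.hom a) S) (map_smul p.2.hom c b)).trans
      (opTensor_smul_right _ _ _)))

theorem continuous_tmul : Continuous fun p : A × B => tmul p.1 p.2 :=
  ((LinearMap.mk₂ ℂ (tmul : A → B → MinTensor A B) tmul_add_left tmul_smul_left tmul_add_right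
    tmul_smul_right).mkContinuous₂ 1
      fun a b => (norm_tmul_le a b).trans_eq (by ring)).continuous₂

/-- A closed ⋆-subalgebra that contains the elementary tensors is everything. -/
theorem mem_of_isClosed (S : NonUnitalStarSubalgebra ℂ (MinTensor A B))
    (hS : IsClosed (S : Set (MinTensor A B))) (h : ∀ a b, tmul a b ∈ S) (x : MinTensor A B) :
    x ∈ S := by
  have h1 : NonUnitalStarAlgebra.adjoin ℂ (Set.range fun p : A × B => pairTmul p.1 p.2) ≤
      NonUnitalStarSubalgebra.map
        (NonUnitalStarSubalgebraClass.subtype (minTensorSubalgebra A B)) S := by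
    refine NonUnitalStarAlgebra.adjoin_le ?_
    rintro _ ⟨⟨a, b⟩, rfl⟩
    exact ⟨tmul a b, h a b, rfl⟩
  have h2 : IsClosed ((fun y : minTensorSubalgebra A B => (y : PairFamily A B)) '' (S : Set (MinTensor A B))) :=
    (isClosed_minTensorSubalgebra A B).isClosedEmbedding_subtypeVal.isClosedMap _ hS
  obtain ⟨y, hy, hyx⟩ := closure_minimal h1 h2 x.2
  exact (Subtype.ext hyx : y = x) ▸ hy

end MinTensor

end MinTensor

section Map

variable {A A' : Type u} {B B' : Type v} [NonUnitalCStarAlgebra A] [NonUnitalCStarAlgebra A']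
  [NonUnitalCStarAlgebra B] [NonUnitalCStarAlgebra B']

/-- Reindexing of families of operators along `(π, ρ) ↦ (π ∘ φ, ρ ∘ ψ)`. -/
noncomputable def pairMap (φ : A →⋆ₙₐ[ℂ] A') (ψ : B →⋆ₙₐ[ℂ] B') :
    PairFamily A B →⋆ₙₐ[ℂ] PairFamily A' B' where
  toFun f := ⟨fun p => f (p.1.comp φ, p.2.comp ψ), by
    obtain ⟨C, hC⟩ := memℓp_infty_iff.1 f.2
    exact memℓp_infty ⟨C, by rintro _ ⟨p, rfl⟩; exact hC ⟨(p.1.comp φ, p.2.comp ψ), rfl⟩⟩⟩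
  map_smul' _ _ := rfl
  map_zero' := rfl
  map_add' _ _ := rfl
  map_mul' _ _ := rfl
  map_star' _ := rfl

theorem pairMap_pairTmul (φ : A →⋆ₙₐ[ℂ] A') (ψ : B →⋆ₙₐ[ℂ] B') (a : A) (b : B) :
    pairMap φ ψ (pairTmul a b) = pairTmul (φ a) (ψ b) := rfl

theorem continuous_pairMap (φ : A →⋆ₙₐ[ℂ] A') (ψ : B →⋆ₙₐ[ℂ] B') : Continuous (pairMap φ ψ) := by
  refine AddMonoidHomClass.continuous_of_bound (pairMap φ ψ) 1 fun f => ?_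
  rw [one_mul]
  exact NonUnitalStarAlgHom.norm_apply_le (pairMap φ ψ) f

theorem pairMap_mem (φ : A →⋆ₙₐ[ℂ] A') (ψ : B →⋆ₙₐ[ℂ] B') {f : PairFamily A B}
    (hf : f ∈ minTensorSubalgebra A B) : pairMap φ ψ f ∈ minTensorSubalgebra A' B' := by
  have h : NonUnitalStarAlgebra.adjoin ℂ (Set.range fun p : A × B => pairTmul p.1 p.2) ≤
      (minTensorSubalgebra A' B').comap (pairMap φ ψ) := by
    refine NonUnitalStarAlgebra.adjoin_le ?_
    rintro _ ⟨⟨a, b⟩, rfl⟩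
    exact (MinTensor.tmul (φ a) (ψ b)).2
  exact closure_minimal (t := pairMap φ ψ ⁻¹' (minTensorSubalgebra A' B' : Set (PairFamily A' B')))
    h ((isClosed_minTensorSubalgebra A' B').preimage (continuous_pairMap φ ψ)) hf

namespace MinTensor

/-- ⋆-homomorphisms that agree on elementary tensors are equal. -/
theorem hom_ext {C : Type*} [NonUnitalCStarAlgebra C] {f g : MinTensor A B →⋆ₙₐ[ℂ] C}
    (h : ∀ a b, f (tmul a b) = g (tmul a b)) : f = g := by
  have hf : Continuous f := AddMonoidHomClass.continuous_of_bound f 1 fun x => by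
    rw [one_mul]; exact NonUnitalStarAlgHom.norm_apply_le f x
  have hg : Continuous g := AddMonoidHomClass.continuous_of_bound g 1 fun x => by
    rw [one_mul]; exact NonUnitalStarAlgHom.norm_apply_le g x
  ext x
  exact mem_of_isClosed (NonUnitalStarAlgHom.equalizer f g) (isClosed_eq hf hg) h x

/-- The ⋆-homomorphism `φ ⊗ ψ` of minimal tensor products. -/
noncomputable def map (φ : A →⋆ₙₐ[ℂ] A') (ψ : B →⋆ₙₐ[ℂ] B') :
    MinTensor A B →⋆ₙₐ[ℂ] MinTensor A' B' where
  toFun x := ⟨pairMap φ ψ x.1, pairMap_mem φ ψ x.2⟩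
  map_smul' _ _ := rfl
  map_zero' := rfl
  map_add' _ _ := rfl
  map_mul' _ _ := rfl
  map_star' _ := rfl

theorem map_tmul (φ : A →⋆ₙₐ[ℂ] A') (ψ : B →⋆ₙₐ[ℂ] B') (a : A) (b : B) :
    map φ ψ (tmul a b) = tmul (φ a) (ψ b) := rfl

theorem map_map_of_leftInverse (φ : A →⋆ₙₐ[ℂ] A') (ψ : B →⋆ₙₐ[ℂ] B') (φ' : A' →⋆ₙₐ[ℂ] A)
    (ψ' : B' →⋆ₙₐ[ℂ] B) (hφ : ∀ a, φ' (φ a) = a) (hψ : ∀ b, ψ' (ψ b) = b) (x : MinTensor A B) :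
    map φ' ψ' (map φ ψ x) = x := by
  have h := hom_ext (f := (map φ' ψ').comp (map φ ψ)) (g := NonUnitalStarAlgHom.id ℂ _)
    fun a b => by
      change tmul (φ' (φ a)) (ψ' (ψ b)) = tmul a b
      rw [hφ, hψ]
  exact DFunLike.congr_fun h x

/-- The ⋆-isomorphism `φ ⊗ ψ` of minimal tensor products. -/
noncomputable def congr (φ : A ≃⋆ₐ[ℂ] A') (ψ : B ≃⋆ₐ[ℂ] B') :
    MinTensor A B ≃⋆ₐ[ℂ] MinTensor A' B' where
  toFun := map (φ : A →⋆ₙₐ[ℂ] A') (ψ : B →⋆ₙₐ[ℂ] B')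
  invFun := map (φ.symm : A' →⋆ₙₐ[ℂ] A) (ψ.symm : B' →⋆ₙₐ[ℂ] B)
  left_inv := map_map_of_leftInverse _ _ _ _ φ.symm_apply_apply ψ.symm_apply_apply
  right_inv := map_map_of_leftInverse _ _ _ _ φ.apply_symm_apply ψ.apply_symm_apply
  map_mul' := map_mul _
  map_add' := map_add _
  map_star' := map_star _
  map_smul' := map_smul _

theorem congr_tmul (φ : A ≃⋆ₐ[ℂ] A') (ψ : B ≃⋆ₐ[ℂ] B') (a : A) (b : B) :
    congr φ ψ (tmul a b) = tmul (φ a) (ψ b) := rfl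

theorem norm_congr_le (φ : A ≃⋆ₐ[ℂ] A') (ψ : B ≃⋆ₐ[ℂ] B') (x : MinTensor A B) :
    ‖congr φ ψ x‖ ≤ ‖x‖ :=
  NonUnitalStarAlgHom.norm_apply_le (map (φ : A →⋆ₙₐ[ℂ] A') (ψ : B →⋆ₙₐ[ℂ] B')) x

end MinTensor

end Map

attribute [irreducible] pairTmul MinTensor.tmul

theorem MinTensor.continuous_tmul_comp {A : Type u} {B : Type v} [NonUnitalCStarAlgebra A]
    [NonUnitalCStarAlgebra B] {X : Type*} [TopologicalSpace X] {f : X → A} {g : X → B}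
    (hf : Continuous f) (hg : Continuous g) : Continuous fun x => MinTensor.tmul (f x) (g x) :=
  MinTensor.continuous_tmul.comp (hf.prodMk hg)

/-! ## Actions -/

/-- An action of a topological group `G` on a C⋆-algebra `A`: a strongly continuous homomorphism
from `G` to the group of ⋆-automorphisms of `A`. -/
structure CStarAction (G : Type*) [Group G] [TopologicalSpace G] (A : Type*)
    [NonUnitalCStarAlgebra A] where
  hom : G →* (A ≃⋆ₐ[ℂ] A)
  continuous_apply : ∀ a : A, Continuous fun s : G => hom s a

namespace CStarAction

instance {G : Type*} [Group G] [TopologicalSpace G] {A : Type*} [NonUnitalCStarAlgebra A] :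
    CoeFun (CStarAction G A) fun _ => G → (A ≃⋆ₐ[ℂ] A) := ⟨fun α => α.hom⟩

/-- The fixed point algebra of an action. -/
def fixedPoints {G : Type*} [Group G] [TopologicalSpace G] {A : Type*} [NonUnitalCStarAlgebra A]
    (α : CStarAction G A) : NonUnitalStarSubalgebra ℂ A where
  carrier := {a | ∀ s, α s a = a}
  zero_mem' s := map_zero _
  add_mem' ha hb s := by rw [map_add, ha s, hb s]
  mul_mem' ha hb s := by rw [map_mul, ha s, hb s]
  smul_mem' c a ha s := by rw [map_smul, ha s]
  star_mem' ha s := by rw [map_star, ha s]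

variable {G : Type*} [CommGroup G] [TopologicalSpace G]

/-- The spectral subspace `A_χ = {a | ∀ s, α_s a = χ(s) a}` of a character `χ`. -/
def spectralSubspace {A : Type*} [NonUnitalCStarAlgebra A] (α : CStarAction G A)
    (χ : PontryaginDual G) : Submodule ℂ A where
  carrier := {a | ∀ s, α s a = (χ s : ℂ) • a}
  zero_mem' s := by simp
  add_mem' ha hb s := by rw [map_add, ha s, hb s, smul_add]
  smul_mem' c a ha s := by rw [map_smul, ha s, smul_comm]

variable {A : Type u} {B : Type v} [NonUnitalCStarAlgebra A]
  [NonUnitalCStarAlgebra B]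

theorem continuous_congr_apply [IsTopologicalGroup G] (α : CStarAction G A) (β : CStarAction G B) (c : MinTensor A B) :
    Continuous fun s : G => MinTensor.congr (α s) (β s⁻¹) c := by
  let S : NonUnitalStarSubalgebra ℂ (MinTensor A B) :=
    { carrier := {c | Continuous fun s : G => MinTensor.congr (α s) (β s⁻¹) c}
      zero_mem' := by simpa using continuous_const
      add_mem' := fun ha hb => (Continuous.add ha hb).congr fun s => (map_add _ _ _).symm
      mul_mem' := fun ha hb => (Continuous.mul ha hb).congr fun s => (map_mul _ _ _).symm
      smul_mem' := fun r a ha => (Continuous.const_smul ha r).congr fun s =>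
        (map_smul (MinTensor.congr (α s) (β s⁻¹)) r a).symm
      star_mem' := fun ha => (Continuous.star ha).congr fun s => (map_star _ _).symm }
  refine MinTensor.mem_of_isClosed S (isClosed_of_closure_subset fun c hc => ?_) (fun a b => ?_) c
  · refine continuous_of_uniform_approx_of_continuous fun u hu => ?_
    obtain ⟨ε, hε, hεu⟩ := Metric.mem_uniformity_dist.1 hu
    obtain ⟨d, hd, hcd⟩ := Metric.mem_closure_iff.1 hc ε hε
    refine ⟨_, hd, fun s => hεu ?_⟩
    rw [dist_eq_norm] at hcd ⊢
    rw [← map_sub]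
    exact (MinTensor.norm_congr_le _ _ _).trans_lt hcd
  · have h : Continuous fun s : G => MinTensor.tmul (α s a) (β s⁻¹ b) :=
      MinTensor.continuous_tmul_comp (α.continuous_apply a)
        ((β.continuous_apply b).comp continuous_inv)
    have h' : Continuous fun s : G => MinTensor.congr (α s) (β s⁻¹) (MinTensor.tmul a b) :=
      h.congr fun s => (MinTensor.congr_tmul (α s) (β s⁻¹) a b).symm
    exact h'

/-- The action `λ` of `G` on `A ⊗ B` with `λ_s (a ⊗ b) = α_s a ⊗ β_{s⁻¹} b`. -/
noncomputable def twist [IsTopologicalGroup G] (α : CStarAction G A) (β : CStarAction G B) :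
    CStarAction G (MinTensor A B) where
  hom :=
    { toFun := fun s => MinTensor.congr (α s) (β s⁻¹)
      map_one' := by
        have h := MinTensor.hom_ext
          (f := (MinTensor.congr (α 1) (β 1⁻¹) : MinTensor A B →⋆ₙₐ[ℂ] MinTensor A B))
          (g := NonUnitalStarAlgHom.id ℂ _) fun a b => by
            refine (MinTensor.congr_tmul (α 1) (β 1⁻¹) a b).trans ?_
            rw [inv_one, map_one, map_one, StarAlgEquiv.one_apply, StarAlgEquiv.one_apply]
            rfl
        exact DFunLike.ext _ _ fun x => DFunLike.congr_fun h x
      map_mul' := fun s t => by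
        have h := MinTensor.hom_ext
          (f := (MinTensor.congr (α (s * t)) (β (s * t)⁻¹) :
            MinTensor A B →⋆ₙₐ[ℂ] MinTensor A B))
          (g := (MinTensor.congr (α s) (β s⁻¹) : MinTensor A B →⋆ₙₐ[ℂ] MinTensor A B).comp
            (MinTensor.congr (α t) (β t⁻¹) : MinTensor A B →⋆ₙₐ[ℂ] MinTensor A B)) fun a b => by
            refine (MinTensor.congr_tmul (α (s * t)) (β (s * t)⁻¹) a b).trans (Eq.trans ?_
              ((congrArg (MinTensor.congr (α s) (β s⁻¹))
                (MinTensor.congr_tmul (α t) (β t⁻¹) a b)).trans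
                  (MinTensor.congr_tmul (α s) (β s⁻¹) (α t a) (β t⁻¹ b))).symm)
            rw [mul_inv, map_mul, map_mul, StarAlgEquiv.mul_apply, StarAlgEquiv.mul_apply]
        exact DFunLike.ext _ _ fun x => DFunLike.congr_fun h x }
  continuous_apply c := continuous_congr_apply α β c

theorem twist_tmul [IsTopologicalGroup G] (α : CStarAction G A) (β : CStarAction G B) (s : G) (a : A) (b : B) :
    α.twist β s (MinTensor.tmul a b) = MinTensor.tmul (α s a) (β s⁻¹ b) :=
  MinTensor.congr_tmul (α s) (β s⁻¹) a b

/-- The `G`-balanced tensor product: the fixed point algebra of the action `λ` on `A ⊗ B`. -/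
noncomputable def balancedTensor [IsTopologicalGroup G] (α : CStarAction G A) (β : CStarAction G B) :
    NonUnitalStarSubalgebra ℂ (MinTensor A B) :=
  (α.twist β).fixedPoints

end CStarAction

/-- A grading of a C⋆-algebra `A` by a group `Γ`: a linearly independent family of closed subspaces
`E g` with `E g * E h ⊆ E (g * h)`, `(E g)⋆ = E g⁻¹` and dense linear span. -/
structure IsCStarGrading {Γ : Type*} [Group Γ] {A : Type*} [NonUnitalCStarAlgebra A]
    (E : Γ → Submodule ℂ A) : Prop where
  isClosed : ∀ g, IsClosed (E g : Set A)
  independent : iSupIndep E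
  mul_mem : ∀ g h, ∀ a ∈ E g, ∀ b ∈ E h, a * b ∈ E (g * h)
  star_eq : ∀ g, star (E g : Set A) = E g⁻¹
  dense : (⨆ g, E g).topologicalClosure = ⊤

/-!
Let `s ↦ U_s` be a strongly continuous representation of the compact abelian group `G` by
isometries of a Banach space, and let `f ∈ C(G)` act by `U f v = ∫ f(s) • U_s v ds`, the integral
taken against the normalized Haar measure (`BanachRep.smoothing`). For a character `χ` the operator
`U χ⁻¹` is a projection onto the joint eigenspace of `χ` and, by orthogonality of characters,
annihilates the other eigenspaces. This gives their independence
(`BanachRep.iSupIndep_spectralSubspace`). Their sum is dense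
(`BanachRep.topologicalClosure_iSup_spectralSubspace`): every `v` is approximated by vectors `U f v`
with `f` concentrated near `1`, and `f` is uniformly approximated by linear combinations of
characters. For the representation underlying a C⋆-dynamical system this is the grading statement.

The approximation rests on the fact that characters separate the points of `G`
(`PontryaginDual.exists_apply_ne_one`), after which Stone–Weierstrass applies. Separation is proved
by Gelfand theory, without compact operators. For the regular representation `U` on `L²(G)`, the
double commutant of `{U_s}` is a commutative unital C⋆-algebra that contains all `U_s` and all
`U f`. If `g ≠ 1`, then `U_g ≠ 1`, so `U_g * U f ≠ U f` for some `f`, and some Gelfand character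
`φ` tells these two operators apart. Then `s ↦ φ (U_s)` is a unitary character that is not `1` at
`g`; it is continuous because `φ (U_s) * φ (U f) = φ (U (f (s⁻¹ * ·)))` with `φ (U f) ≠ 0`
(`BanachRep.exists_character_of_hom_apply_ne`).

For the fixed point algebra of the action `λ` on `A ⊗ B`, let `P = ∫ λ_s ds`. It is continuous and
fixes the fixed points of `λ`. If `a ∈ A_χ` and `b ∈ B_ψ`, then `a ⊗ b` is an eigenvector of `λ` for
`χ * ψ⁻¹`, so `P (a ⊗ b)` is `a ⊗ b` when `χ = ψ` and `0` otherwise. Since these `a ⊗ b` span a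
dense subspace (`MinTensor.eq_top_of_forall_tmul_mem_of_dense`), `P` maps `A ⊗ B` into the closed
span of the `a ⊗ b` with `χ = ψ`.
-/

open MeasureTheory

/-! ### Representations and their integrated form -/

/-- A strongly continuous representation of a topological group by contractions (hence, by
invertibility, by isometries) of a complex normed space. -/
structure BanachRep (G : Type*) [Group G] [TopologicalSpace G] (E : Type*)
    [NormedAddCommGroup E] [NormedSpace ℂ E] where
  hom : G →* (E →L[ℂ] E)
  norm_apply_le : ∀ s v, ‖hom s v‖ ≤ ‖v‖
  continuous_apply : ∀ v, Continuous fun s => hom s v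

namespace BanachRep

section Basic

variable {G : Type*} [Group G] [TopologicalSpace G] {E : Type*}
    [NormedAddCommGroup E] [NormedSpace ℂ E] (U : BanachRep G E)

theorem hom_one_apply (v : E) : U.hom 1 v = v := by rw [map_one]; rfl

theorem hom_mul_apply (s t : G) (v : E) : U.hom (s * t) v = U.hom s (U.hom t v) := by
  rw [map_mul]; rfl

theorem norm_apply (s : G) (v : E) : ‖U.hom s v‖ = ‖v‖ := by
  refine le_antisymm (U.norm_apply_le s v) ?_
  conv_lhs => rw [← U.hom_one_apply v, ← inv_mul_cancel s, hom_mul_apply]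
  exact U.norm_apply_le _ _

theorem continuous_smul_apply (f : C(G, ℂ)) (v : E) : Continuous fun s => f s • U.hom s v :=
  f.continuous.smul (U.continuous_apply v)

end Basic

section Smoothing

variable {G : Type*} [Group G] [TopologicalSpace G] [CompactSpace G]
  [MeasurableSpace G] [BorelSpace G] {E : Type*}
  [NormedAddCommGroup E] [NormedSpace ℂ E] (U : BanachRep G E) (μ : Measure G)
  [IsProbabilityMeasure μ]

theorem integrable_smul_apply (f : C(G, ℂ)) (v : E) :
    Integrable (fun s => f s • U.hom s v) μ :=
  (U.continuous_smul_apply f v).integrable_of_hasCompactSupport (HasCompactSupport.of_compactSpace _)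

/-- The integrated form of a representation: `f` acts by `v ↦ ∫ f(s) • U_s v ds`. -/
noncomputable def smoothing : C(G, ℂ) →L[ℂ] E →L[ℂ] E :=
  (LinearMap.mk₂ ℂ (fun f v => ∫ s, f s • U.hom s v ∂μ)
    (fun f g v => by
      simp only [ContinuousMap.add_apply, add_smul]
      exact integral_add (U.integrable_smul_apply μ f v) (U.integrable_smul_apply μ g v))
    (fun c f v => by
      simp only [ContinuousMap.smul_apply, smul_assoc]
      exact integral_smul _ _)
    (fun f v w => by
      simp only [map_add, smul_add]
      exact integral_add (U.integrable_smul_apply μ f v) (U.integrable_smul_apply μ f w))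
    (fun c f v => by
      simp only [map_smul, smul_comm _ c]
      exact integral_smul _ _)).mkContinuous₂ 1 fun f v => by
    refine (norm_integral_le_of_norm_le_const (C := ‖f‖ * ‖v‖) (.of_forall fun s => ?_)).trans ?_
    · rw [norm_smul, U.norm_apply]
      exact mul_le_mul_of_nonneg_right (f.norm_coe_le_norm s) (norm_nonneg v)
    · simp

theorem smoothing_apply (f : C(G, ℂ)) (v : E) :
    U.smoothing μ f v = ∫ s, f s • U.hom s v ∂μ := rfl

variable [CompleteSpace E]

/-- An operator that intertwines the representations intertwines their integrated forms. -/
theorem smoothing_comm {F : Type*} [NormedAddCommGroup F] [NormedSpace ℂ F] [CompleteSpace F]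
    (V : BanachRep G F) {T : E →L[ℂ] F} (hT : ∀ s v, T (U.hom s v) = V.hom s (T v))
    (f : C(G, ℂ)) (v : E) : T (U.smoothing μ f v) = V.smoothing μ f (T v) := by
  rw [smoothing_apply, smoothing_apply,
    ← ContinuousLinearMap.integral_comp_comm T (U.integrable_smul_apply μ f v)]
  simp only [map_smul, hT]

variable [IsTopologicalGroup G]

theorem hom_smoothing [μ.IsMulLeftInvariant] (t : G) (f : C(G, ℂ)) (v : E) :
    U.hom t (U.smoothing μ f v) =
      U.smoothing μ (f.comp (ContinuousMap.mulLeft t⁻¹)) v := by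
  rw [smoothing_apply, smoothing_apply,
    ← ContinuousLinearMap.integral_comp_comm _ (U.integrable_smul_apply μ f v),
    ← integral_mul_left_eq_self (μ := μ)
      (fun s => (f.comp (ContinuousMap.mulLeft t⁻¹)) s • U.hom s v) t]
  simp

/-- Integrating against functions concentrated near the identity approximates the identity. -/
theorem exists_norm_smoothing_sub_lt [T2Space G] [μ.IsOpenPosMeasure] (v : E) {ε : ℝ}
    (hε : 0 < ε) : ∃ f : C(G, ℂ), ‖U.smoothing μ f v - v‖ < ε := by
  have hopen : IsOpen {s : G | ‖U.hom s v - v‖ < ε / 2} :=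
    isOpen_lt ((U.continuous_apply v).sub continuous_const).norm continuous_const
  obtain ⟨f, hf0, hf1, hf⟩ := exists_continuous_zero_one_of_isClosed hopen.isClosed_compl
    (isClosed_singleton (x := (1 : G))) (by
      rw [Set.disjoint_singleton_right, Set.mem_compl_iff, not_not]
      simpa [U.hom_one_apply] using hε)
  have hfint : Integrable f μ :=
    f.continuous.integrable_of_hasCompactSupport (HasCompactSupport.of_compactSpace _)
  have hpos : 0 < ∫ s, f s ∂μ :=
    f.continuous.integral_pos_of_hasCompactSupport_nonneg_nonzero (HasCompactSupport.of_compactSpace _)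
      (fun s => (hf s).1) (x := 1) (by rw [hf1 rfl]; exact one_ne_zero)
  -- `f` divided by its integral is a probability density supported where `U_s v` is close to `v`
  set c : ℝ := ∫ s, f s ∂μ with hc
  let g : C(G, ℂ) := ⟨fun s => ((f s / c : ℝ) : ℂ), by fun_prop⟩
  have hg : ∫ s, g s ∂μ = 1 := by
    change ∫ s, ((f s / c : ℝ) : ℂ) ∂μ = 1
    rw [integral_complex_ofReal, integral_div, ← hc, div_self hpos.ne', Complex.ofReal_one]
  refine ⟨g, lt_of_le_of_lt ?_ (half_lt_self hε)⟩
  have hgv : Integrable (fun s => g s • v) μ :=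
    (g.continuous.smul continuous_const).integrable_of_hasCompactSupport
      (HasCompactSupport.of_compactSpace _)
  have hsub : U.smoothing μ g v - v = ∫ s, (g s • U.hom s v - g s • v) ∂μ := by
    rw [integral_sub (U.integrable_smul_apply μ g v) hgv, integral_smul_const, hg, one_smul]
    rfl
  rw [hsub]
  calc ‖∫ s, (g s • U.hom s v - g s • v) ∂μ‖ ≤ ∫ s, f s / c * (ε / 2) ∂μ := by
        refine norm_integral_le_of_norm_le ((hfint.div_const c).mul_const _) (.of_forall fun s => ?_)
        have h0 : 0 ≤ f s / c := div_nonneg (hf s).1 hpos.le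
        rw [← smul_sub, norm_smul]
        change ‖((f s / c : ℝ) : ℂ)‖ * _ ≤ _
        rw [Complex.norm_real, Real.norm_of_nonneg h0]
        by_cases hs : ‖U.hom s v - v‖ < ε / 2
        · exact mul_le_mul_of_nonneg_left hs.le h0
        · have : f s = 0 := hf0 hs
          simp [this]
    _ = ε / 2 := by
        rw [integral_mul_const, integral_div, ← hc, div_self hpos.ne', one_mul]

end Smoothing

end BanachRep

/-! ### The commutative von Neumann algebra of a unitary representation -/

namespace BanachRep

section Hilbert

variable {G : Type*} [Group G] [TopologicalSpace G] {H : Type*}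
  [NormedAddCommGroup H] [InnerProductSpace ℂ H] [CompleteSpace H] (U : BanachRep G H)

/-- On a Hilbert space the operators of a `BanachRep` are unitary. -/
theorem star_hom (s : G) : star (U.hom s) = U.hom s⁻¹ := by
  rw [ContinuousLinearMap.star_eq_adjoint, eq_comm, ContinuousLinearMap.eq_adjoint_iff]
  intro x y
  have h := LinearIsometry.inner_map_map ⟨(U.hom s : H →ₗ[ℂ] H), U.norm_apply s⟩ (U.hom s⁻¹ x) y
  change inner ℂ (U.hom s (U.hom s⁻¹ x)) (U.hom s y) = _ at h
  rwa [← hom_mul_apply, mul_inv_cancel, hom_one_apply, eq_comm] at h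

/-- The von Neumann algebra generated by a representation: the double commutant of its range. -/
noncomputable def vonNeumannAlgebra : StarSubalgebra ℂ (H →L[ℂ] H) :=
  StarSubalgebra.centralizer ℂ (StarSubalgebra.centralizer ℂ (Set.range U.hom) : Set (H →L[ℂ] H))

theorem mem_centralizer_range_iff {T : H →L[ℂ] H} :
    T ∈ StarSubalgebra.centralizer ℂ (Set.range U.hom) ↔ ∀ s, U.hom s * T = T * U.hom s := by
  rw [StarSubalgebra.mem_centralizer_iff]
  refine ⟨fun h s => (h _ ⟨s, rfl⟩).1, ?_⟩
  rintro h _ ⟨s, rfl⟩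
  exact ⟨h s, by rw [star_hom, h]⟩

theorem mem_vonNeumannAlgebra_iff {T : H →L[ℂ] H} : T ∈ U.vonNeumannAlgebra ↔
    ∀ R ∈ StarSubalgebra.centralizer ℂ (Set.range U.hom), R * T = T * R := by
  rw [vonNeumannAlgebra, StarSubalgebra.mem_centralizer_iff]
  exact ⟨fun h R hR => (h R hR).1, fun h R hR => ⟨h R hR, h _ (star_mem hR)⟩⟩

theorem isClosed_vonNeumannAlgebra : IsClosed (U.vonNeumannAlgebra : Set (H →L[ℂ] H)) := by
  rw [vonNeumannAlgebra, StarSubalgebra.coe_centralizer]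
  exact Set.isClosed_centralizer _

theorem hom_mem_vonNeumannAlgebra (s : G) : U.hom s ∈ U.vonNeumannAlgebra :=
  U.mem_vonNeumannAlgebra_iff.2 fun _ hR => ((U.mem_centralizer_range_iff.1 hR) s).symm

theorem smoothing_mem_vonNeumannAlgebra [CompactSpace G] [MeasurableSpace G] [BorelSpace G]
    (μ : Measure G) [IsProbabilityMeasure μ] (f : C(G, ℂ)) :
    U.smoothing μ f ∈ U.vonNeumannAlgebra := by
  refine U.mem_vonNeumannAlgebra_iff.2 fun R hR => ?_
  ext v
  refine U.smoothing_comm μ U (T := R) (fun s w => ?_) f v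
  exact (DFunLike.congr_fun (U.mem_centralizer_range_iff.1 hR s) w).symm

end Hilbert

section CommHilbert

variable {G : Type*} [CommGroup G] [TopologicalSpace G] {H : Type*}
  [NormedAddCommGroup H] [InnerProductSpace ℂ H] [CompleteSpace H] (U : BanachRep G H)

theorem commute_of_mem_vonNeumannAlgebra {S T : H →L[ℂ] H} (hS : S ∈ U.vonNeumannAlgebra)
    (hT : T ∈ U.vonNeumannAlgebra) : S * T = T * S := by
  refine U.mem_vonNeumannAlgebra_iff.1 hT S (U.mem_centralizer_range_iff.2 fun s => ?_)
  refine U.mem_vonNeumannAlgebra_iff.1 hS _ (U.mem_centralizer_range_iff.2 fun t => ?_)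
  rw [← map_mul, ← map_mul, mul_comm]

noncomputable instance : CommCStarAlgebra U.vonNeumannAlgebra :=
  { StarSubalgebra.cstarAlgebra U.vonNeumannAlgebra (h_closed := U.isClosed_vonNeumannAlgebra) with
    mul_comm := fun S T => Subtype.ext (U.commute_of_mem_vonNeumannAlgebra S.2 T.2) }

variable [CompactSpace G] [T2Space G] [IsTopologicalGroup G]

/-- A Gelfand character `φ` of the commutative von Neumann algebra generated by `U` restricts to the
character `s ↦ φ (U s)` of `G`. It is continuous when `φ` does not vanish on some integrated
operator `U f`, since `φ (U s) * φ (U f) = φ (U (f (s⁻¹ * ·)))`. -/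
theorem exists_character_of_hom_apply_ne [MeasurableSpace G] [BorelSpace G] (μ : Measure G)
    [IsProbabilityMeasure μ] [μ.IsHaarMeasure] {g : G} {v : H} (hv : U.hom g v ≠ v) :
    ∃ χ : PontryaginDual G, χ g ≠ 1 := by
  let u : G → U.vonNeumannAlgebra := fun s => ⟨U.hom s, U.hom_mem_vonNeumannAlgebra s⟩
  let T : C(G, ℂ) → U.vonNeumannAlgebra := fun f =>
    ⟨U.smoothing μ f, U.smoothing_mem_vonNeumannAlgebra μ f⟩
  have hT : Continuous T := (U.smoothing μ).continuous.subtype_mk _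
  have u_one : u 1 = 1 := Subtype.ext (map_one U.hom)
  have u_mul (s t : G) : u (s * t) = u s * u t := Subtype.ext (map_mul U.hom s t)
  have u_star (s : G) : star (u s) = u s⁻¹ := Subtype.ext (U.star_hom s)
  have u_T (s : G) (f : C(G, ℂ)) : u s * T f = T (f.comp (ContinuousMap.mulLeft s⁻¹)) :=
    Subtype.ext (ContinuousLinearMap.ext fun w => U.hom_smoothing μ s f w)
  -- otherwise `U_g` would fix every `U f v`, hence their limit `v`
  obtain ⟨f, hf⟩ : ∃ f, u g * T f ≠ T f := by
    by_contra! h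
    have key (f : C(G, ℂ)) : U.hom g (U.smoothing μ f v) = U.smoothing μ f v :=
      DFunLike.congr_fun (congrArg Subtype.val (h f)) v
    refine hv (eq_of_forall_dist_le fun ε hε => ?_)
    obtain ⟨f, hf⟩ := U.exists_norm_smoothing_sub_lt μ v (half_pos hε)
    calc dist (U.hom g v) v
        ≤ dist (U.hom g v) (U.hom g (U.smoothing μ f v)) + dist (U.smoothing μ f v) v := by
          rw [key]; exact dist_triangle _ _ _
      _ = ‖U.smoothing μ f v - v‖ + ‖U.smoothing μ f v - v‖ := by
          rw [dist_eq_norm, ← map_sub, U.norm_apply, dist_eq_norm, norm_sub_rev]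
      _ ≤ ε := by linarith
  obtain ⟨φ, hφ⟩ := DFunLike.ne_iff.1
    ((gelfandTransform_isometry U.vonNeumannAlgebra).injective.ne hf)
  change φ (u g * T f) ≠ φ (T f) at hφ
  rw [map_mul] at hφ
  have hTf : φ (T f) ≠ 0 := fun h => hφ (by rw [h, mul_zero])
  have hnorm (s : G) : ‖φ (u s)‖ = 1 := by
    have h : φ (u s) * star (φ (u s)) = 1 := by
      rw [← map_star, u_star, ← map_mul, ← u_mul, mul_inv_cancel, u_one, map_one]
    have h' := congrArg norm h
    rw [norm_mul, norm_star, norm_one] at h'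
    nlinarith [norm_nonneg (φ (u s))]
  have hcont : Continuous fun s => φ (u s) := by
    have h : (fun s => φ (u s)) =
        fun s => φ (T (f.comp (ContinuousMap.mulLeft s⁻¹))) / φ (T f) := by
      funext s
      rw [← u_T, map_mul, mul_div_cancel_right₀ _ hTf]
    have hshift : Continuous fun s : G => f.comp (ContinuousMap.mulLeft s⁻¹) :=
      (ContinuousMap.curry ⟨fun p : G × G => f (p.1⁻¹ * p.2), by fun_prop⟩).continuous
    rw [h]
    exact ((map_continuous φ).comp (hT.comp hshift)).div_const _
  let χ : G →ₜ* Circle :=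
    { toFun := fun s => ⟨φ (u s), mem_sphere_zero_iff_norm.2 (hnorm s)⟩
      map_one' := Circle.ext ((congrArg φ u_one).trans (map_one φ))
      map_mul' := fun s t => Circle.ext ((congrArg φ (u_mul s t)).trans (map_mul φ _ _))
      continuous_toFun := hcont.subtype_mk _ }
  refine ⟨χ, fun h => hφ ?_⟩
  have : φ (u g) = 1 := congrArg Subtype.val h
  rw [this, one_mul]

end CommHilbert

end BanachRep

/-! ### The regular representation and separation of points -/

/-- The regular representation of a compact abelian group on `L²`, by `(U_s f) t = f (s * t)`. -/
noncomputable def regularRep {G : Type*} [CommGroup G] [TopologicalSpace G] [IsTopologicalGroup G]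
    [CompactSpace G] [MeasurableSpace G] [BorelSpace G] (μ : Measure G) [μ.Regular]
    [μ.IsMulLeftInvariant] : BanachRep G (Lp ℂ 2 μ) where
  hom :=
    { toFun := fun s => LinearMap.mkContinuous
        { toFun := fun v => DomMulAct.mk s • v
          map_add' := fun v w => smul_add _ v w
          map_smul' := fun c v => smul_comm _ c v } 1
        fun v => by rw [one_mul]; exact (DomMulAct.norm_smul_Lp _ v).le
      map_one' := ContinuousLinearMap.ext fun v => one_smul Gᵈᵐᵃ v
      map_mul' := fun s t => ContinuousLinearMap.ext fun v => by
        rw [mul_comm s t]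
        exact mul_smul (DomMulAct.mk s) (DomMulAct.mk t) v }
  norm_apply_le s v := (DomMulAct.norm_smul_Lp _ v).le
  continuous_apply v := by
    have : Fact ((2 : ℝ≥0∞) ≠ ∞) := ⟨ENNReal.ofNat_ne_top⟩
    exact (DomMulAct.continuous_mk (M := G)).smul (continuous_const (y := v))

theorem regularRep_toLp {G : Type*} [CommGroup G] [TopologicalSpace G] [IsTopologicalGroup G]
    [CompactSpace G] [MeasurableSpace G] [BorelSpace G] (μ : Measure G) [μ.Regular]
    [μ.IsMulLeftInvariant] (s : G) (f : C(G, ℂ)) :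
    (regularRep μ).hom s (ContinuousMap.toLp 2 μ ℂ f) =
      ContinuousMap.toLp 2 μ ℂ (f.comp (ContinuousMap.mulLeft s)) := by
  have hs : MeasurePreserving (fun t => s • t) μ μ := measurePreserving_smul s μ
  refine Lp.ext ((DomMulAct.smul_Lp_ae_eq (DomMulAct.mk s) _).trans ?_)
  exact (hs.quasiMeasurePreserving.ae_eq_comp (ContinuousMap.coeFn_toLp μ f)).trans
    (ContinuousMap.coeFn_toLp μ (f.comp (ContinuousMap.mulLeft s))).symm

theorem PontryaginDual.exists_apply_ne_one {G : Type*} [CommGroup G] [TopologicalSpace G]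
    [IsTopologicalGroup G] [CompactSpace G] [T2Space G] {g : G} (hg : g ≠ 1) :
    ∃ χ : PontryaginDual G, χ g ≠ 1 := by
  borelize G
  let μ : Measure G := Measure.haarMeasure ⊤
  have : IsProbabilityMeasure μ := ⟨Measure.haarMeasure_self⟩
  obtain ⟨f, hf0, hf1, -⟩ := exists_continuous_zero_one_of_isClosed
    (isClosed_singleton (x := (1 : G))) (isClosed_singleton (x := g))
    (Set.disjoint_singleton.2 hg.symm)
  let F : C(G, ℂ) := ⟨fun s => (f s : ℂ), by fun_prop⟩
  refine (regularRep μ).exists_character_of_hom_apply_ne μ (g := g)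
    (v := ContinuousMap.toLp 2 μ ℂ F) fun h => ?_
  rw [regularRep_toLp] at h
  have h1 := DFunLike.congr_fun (ContinuousMap.toLp_injective μ h) 1
  change ((f (g * 1) : ℝ) : ℂ) = ((f 1 : ℝ) : ℂ) at h1
  rw [mul_one, hf0 rfl, hf1 rfl] at h1
  simp at h1

/-! ### Trigonometric polynomials -/

namespace PontryaginDual

variable {G : Type*} [CommGroup G] [TopologicalSpace G]

/-- A character as a complex-valued continuous function. -/
noncomputable def toComplex : PontryaginDual G →* C(G, ℂ) where
  toFun χ := ⟨fun s => (χ s : ℂ), by fun_prop⟩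
  map_one' := rfl
  map_mul' _ _ := rfl

theorem toComplex_apply (χ : PontryaginDual G) (s : G) :
    toComplex χ s = (χ s : ℂ) := rfl

theorem coe_inv_apply (χ : PontryaginDual G) (s : G) : (χ⁻¹ s : ℂ) = (χ s : ℂ)⁻¹ :=
  Circle.coe_inv (χ s)

theorem coe_map_inv (χ : PontryaginDual G) (s : G) : (χ s⁻¹ : ℂ) = (χ s : ℂ)⁻¹ := by
  rw [map_inv, Circle.coe_inv]

/-- The trigonometric polynomials, i.e. the linear combinations of characters. -/
noncomputable def trigPolynomials : StarSubalgebra ℂ C(G, ℂ) where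
  carrier := Submodule.span ℂ (Set.range (toComplex (G := G)))
  mul_mem' {f g} hf hg := by
    have h : (Submodule.span ℂ (Set.range (toComplex (G := G)))) *
        Submodule.span ℂ (Set.range (toComplex (G := G))) ≤
        Submodule.span ℂ (Set.range (toComplex (G := G))) := by
      rw [Submodule.span_mul_span]
      refine Submodule.span_mono ?_
      rintro _ ⟨_, ⟨χ, rfl⟩, _, ⟨ψ, rfl⟩, rfl⟩
      exact ⟨χ * ψ, _root_.map_mul toComplex χ ψ⟩
    exact h (Submodule.mul_mem_mul hf hg)
  add_mem' hf hg := add_mem hf hg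
  algebraMap_mem' c := by
    rw [Algebra.algebraMap_eq_smul_one]
    exact Submodule.smul_mem _ c (Submodule.subset_span ⟨1, _root_.map_one toComplex⟩)
  star_mem' {f} hf := by
    change star f ∈ Submodule.span ℂ (Set.range (toComplex (G := G)))
    refine Submodule.span_induction ?_ ?_ ?_ ?_ hf
    · rintro _ ⟨χ, rfl⟩
      refine Submodule.subset_span ⟨χ⁻¹, ContinuousMap.ext fun s => ?_⟩
      exact (coe_inv_apply χ s).trans (Circle.coe_inv_eq_conj (χ s))
    · rw [star_zero]; exact zero_mem _
    · intro f g _ _ hf hg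
      rw [star_add]; exact add_mem hf hg
    · intro c f _ hf
      rw [star_smul]; exact Submodule.smul_mem _ _ hf

/-- Orthogonality of characters. -/
theorem integral_eq_zero [MeasurableSpace G] [BorelSpace G] (μ : Measure G)
    [IsTopologicalGroup G] [μ.IsMulLeftInvariant] {χ : PontryaginDual G} (hχ : χ ≠ 1) : ∫ s, (χ s : ℂ) ∂μ = 0 := by
  obtain ⟨t, ht⟩ := DFunLike.ne_iff.1 hχ
  have h := integral_mul_left_eq_self (μ := μ) (fun s => (χ s : ℂ)) t
  simp only [_root_.map_mul, Circle.coe_mul, integral_const_mul] at h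
  by_contra h0
  exact ht (Circle.ext ((mul_eq_right₀ h0).1 h))

variable [IsTopologicalGroup G] [CompactSpace G] [T2Space G]

/-- Trigonometric polynomials are dense in the continuous functions, by Stone–Weierstrass. -/
theorem topologicalClosure_span_toComplex :
    (Submodule.span ℂ (Set.range (toComplex (G := G)))).topologicalClosure = ⊤ := by
  have hsep : (trigPolynomials (G := G)).SeparatesPoints := by
    intro s t hst
    obtain ⟨χ, hχ⟩ := exists_apply_ne_one (g := s * t⁻¹) (by rwa [Ne, mul_inv_eq_one])
    refine ⟨toComplex χ, ⟨_, Submodule.subset_span ⟨χ, rfl⟩, rfl⟩, fun h => hχ ?_⟩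
    rw [_root_.map_mul, map_inv, mul_inv_eq_one]
    exact Circle.ext h
  have h := ContinuousMap.starSubalgebra_topologicalClosure_eq_top_of_separatesPoints _ hsep
  exact SetLike.coe_injective (congrArg (SetLike.coe (A := StarSubalgebra ℂ C(G, ℂ))) h)

end PontryaginDual

/-! ### Joint eigenspaces -/

namespace BanachRep

variable {G : Type*} [CommGroup G] [TopologicalSpace G]
  {E : Type*} [NormedAddCommGroup E] [NormedSpace ℂ E] (U : BanachRep G E)

/-- The joint eigenspace of a representation for a character. -/
def spectralSubspace (χ : PontryaginDual G) : Submodule ℂ E where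
  carrier := {v | ∀ s, U.hom s v = (χ s : ℂ) • v}
  zero_mem' s := by simp
  add_mem' ha hb s := by rw [map_add, ha s, hb s, smul_add]
  smul_mem' c a ha s := by rw [map_smul, ha s, smul_comm]

theorem isClosed_spectralSubspace (χ : PontryaginDual G) :
    IsClosed (U.spectralSubspace χ : Set E) := by
  have h : (U.spectralSubspace χ : Set E) = ⋂ s, {v | U.hom s v = (χ s : ℂ) • v} :=
    Set.ext fun v => by rw [Set.mem_iInter]; rfl
  rw [h]
  exact isClosed_iInter fun s => isClosed_eq (U.hom s).continuous (continuous_const_smul _)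

section Haar

variable [CompactSpace G] [CompleteSpace E] [MeasurableSpace G] [BorelSpace G] (μ : Measure G)
  [IsProbabilityMeasure μ]

open PontryaginDual (toComplex)

theorem smoothing_apply_of_mem_spectralSubspace (f : C(G, ℂ)) {χ : PontryaginDual G} {v : E}
    (hv : v ∈ U.spectralSubspace χ) : U.smoothing μ f v = (∫ s, f s * (χ s : ℂ) ∂μ) • v := by
  rw [smoothing_apply, ← integral_smul_const]
  exact integral_congr_ae (.of_forall fun s => by simp only [hv s, smul_smul])

theorem smoothing_inv_apply_of_mem {χ : PontryaginDual G} {v : E}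
    (hv : v ∈ U.spectralSubspace χ) : U.smoothing μ (toComplex χ⁻¹) v = v := by
  rw [U.smoothing_apply_of_mem_spectralSubspace μ _ hv]
  simp [PontryaginDual.toComplex_apply, PontryaginDual.coe_inv_apply]

variable [IsTopologicalGroup G] [μ.IsMulLeftInvariant]

theorem smoothing_inv_apply_of_mem_of_ne {χ ψ : PontryaginDual G} (hχψ : ψ ≠ χ) {v : E}
    (hv : v ∈ U.spectralSubspace ψ) : U.smoothing μ (toComplex χ⁻¹) v = 0 := by
  rw [U.smoothing_apply_of_mem_spectralSubspace μ _ hv]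
  have h : ∫ s, ((χ⁻¹ * ψ) s : ℂ) ∂μ = 0 :=
    PontryaginDual.integral_eq_zero μ fun h => hχψ (inv_mul_eq_one.1 h).symm
  exact (congrArg (· • v) h).trans (zero_smul ℂ v)

theorem smoothing_toComplex_mem (χ : PontryaginDual G) (v : E) :
    U.smoothing μ (toComplex χ) v ∈ U.spectralSubspace χ⁻¹ := by
  intro t
  have h : (toComplex χ).comp (ContinuousMap.mulLeft t⁻¹) =
      (χ⁻¹ t : ℂ) • toComplex χ := ContinuousMap.ext fun s => by
    change (χ (t⁻¹ * s) : ℂ) = (χ⁻¹ t : ℂ) * (χ s : ℂ)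
    rw [map_mul, Circle.coe_mul, PontryaginDual.coe_map_inv, PontryaginDual.coe_inv_apply]
  rw [hom_smoothing, h, map_smul]
  rfl

end Haar

section Decomposition

variable [IsTopologicalGroup G] [CompactSpace G] [CompleteSpace E]

/-- The projection `v ↦ ∫ conj (χ s) • U_s v ds` is the identity on the `χ`-eigenspace and
annihilates the others. -/
theorem iSupIndep_spectralSubspace : iSupIndep U.spectralSubspace := by
  borelize G
  let μ : Measure G := Measure.haarMeasure ⊤
  have : IsProbabilityMeasure μ := ⟨Measure.haarMeasure_self⟩
  intro χ
  rw [Submodule.disjoint_def]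
  intro v hv hv'
  have h : (⨆ (ψ) (_ : ψ ≠ χ), U.spectralSubspace ψ) ≤
      LinearMap.ker (U.smoothing μ (PontryaginDual.toComplex χ⁻¹)).toLinearMap :=
    iSup₂_le fun ψ hψ w hw => U.smoothing_inv_apply_of_mem_of_ne μ hψ hw
  rw [← U.smoothing_inv_apply_of_mem μ hv]
  exact h hv'

theorem topologicalClosure_iSup_spectralSubspace [T2Space G] :
    (⨆ χ, U.spectralSubspace χ).topologicalClosure = ⊤ := by
  borelize G
  let μ : Measure G := Measure.haarMeasure ⊤
  have : IsProbabilityMeasure μ := ⟨Measure.haarMeasure_self⟩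
  rw [eq_top_iff]
  intro v _
  set M := (⨆ χ, U.spectralSubspace χ).topologicalClosure with hM
  have hMc : IsClosed (M : Set E) := Submodule.isClosed_topologicalClosure _
  let Φ : C(G, ℂ) →L[ℂ] E := (ContinuousLinearMap.apply ℂ E v).comp (U.smoothing μ)
  -- smoothing `v` by a trigonometric polynomial gives a sum of eigenvectors
  have hΦ : (⊤ : Submodule ℂ C(G, ℂ)) ≤ M.comap Φ.toLinearMap := by
    rw [← PontryaginDual.topologicalClosure_span_toComplex]
    refine Submodule.topologicalClosure_minimal _ (Submodule.span_le.2 ?_)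
      (hMc.preimage Φ.continuous)
    rintro _ ⟨χ, rfl⟩
    exact Submodule.le_topologicalClosure _
      (le_iSup U.spectralSubspace χ⁻¹ (U.smoothing_toComplex_mem μ χ v))
  refine hMc.closure_subset_iff.2 subset_rfl (Metric.mem_closure_iff.2 fun ε hε => ?_)
  obtain ⟨f, hf⟩ := U.exists_norm_smoothing_sub_lt μ v hε
  exact ⟨_, hΦ (Submodule.mem_top (x := f)), by rwa [dist_comm, dist_eq_norm]⟩

end Decomposition

end BanachRep

/-! ### Elementary tensors in the minimal tensor product -/

section OpTensor

variable {H : Type u} {K : Type v} [NormedAddCommGroup H] [InnerProductSpace ℂ H]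
  [NormedAddCommGroup K] [InnerProductSpace ℂ K]

theorem opTensor_mul (S S' : H →L[ℂ] H) (T T' : K →L[ℂ] K) :
    opTensor (S * S') (T * T') = opTensor S T * opTensor S' T' := by
  ext x
  induction x using UniformSpace.Completion.induction_on with
  | hp => exact isClosed_eq (by fun_prop) (by fun_prop)
  | ih x =>
    simp only [opTensor, mul_apply_eq_comp,
      ContinuousLinearMap.completion_apply_coe]
    induction x using TensorProduct.induction_on with
    | zero => simp
    | tmul x y => simp
    | add x y hx hy => simp only [map_add, UniformSpace.Completion.coe_add, hx, hy]

theorem star_opTensor [CompleteSpace H] [CompleteSpace K] (S : H →L[ℂ] H) (T : K →L[ℂ] K) :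
    star (opTensor S T) = opTensor (star S) (star T) := by
  rw [ContinuousLinearMap.star_eq_adjoint, eq_comm, ContinuousLinearMap.eq_adjoint_iff]
  intro x y
  induction x, y using UniformSpace.Completion.induction_on₂ with
  | hp => exact isClosed_eq (by fun_prop) (by fun_prop)
  | ih x y =>
    simp only [opTensor, ContinuousLinearMap.completion_apply_coe,
      UniformSpace.Completion.inner_coe]
    induction x using TensorProduct.induction_on with
    | zero => simp
    | add x x' hx hx' => simp only [map_add, inner_add_left, hx, hx']
    | tmul x x' =>
      induction y using TensorProduct.induction_on with
      | zero => simp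
      | add y y' hy hy' => simp only [map_add, inner_add_right, hy, hy']
      | tmul y y' =>
        simp [ContinuousLinearMap.star_eq_adjoint, ContinuousLinearMap.adjoint_inner_left]

end OpTensor

namespace MinTensor

variable {A : Type u} {B : Type v} [NonUnitalCStarAlgebra A] [NonUnitalCStarAlgebra B]

theorem tmul_mul_tmul (a a' : A) (b b' : B) :
    tmul a b * tmul a' b' = tmul (a * a') (b * b') := by
  refine Subtype.ext (Eq.trans (congrArg₂ (· * ·) (coe_tmul a b) (coe_tmul a' b')) ?_)
  rw [coe_tmul]
  refine Subtype.ext (funext fun p => ?_)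
  change pairTmul a b p * pairTmul a' b' p = pairTmul (a * a') (b * b') p
  rw [pairTmul_apply, pairTmul_apply, pairTmul_apply, map_mul, map_mul]
  exact (opTensor_mul _ _ _ _).symm

theorem star_tmul (a : A) (b : B) : star (tmul a b) = tmul (star a) (star b) := by
  refine Subtype.ext (Eq.trans (congrArg star (coe_tmul a b)) ?_)
  rw [coe_tmul]
  refine Subtype.ext (funext fun p => ?_)
  change star (pairTmul a b p) = pairTmul (star a) (star b) p
  rw [pairTmul_apply, pairTmul_apply, map_star, map_star]
  exact star_opTensor _ _

variable (A B)

/-- The linear combinations of elementary tensors form a ⋆-subalgebra. -/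
noncomputable def algTensor : NonUnitalStarSubalgebra ℂ (MinTensor A B) where
  carrier := Submodule.span ℂ (Set.range fun p : A × B => tmul p.1 p.2)
  zero_mem' := zero_mem _
  add_mem' hx hy := add_mem hx hy
  smul_mem' c _ hx := Submodule.smul_mem _ c hx
  mul_mem' {x y} hx hy := by
    change x * y ∈ Submodule.span ℂ (Set.range fun p : A × B => tmul p.1 p.2)
    induction hx, hy using Submodule.span_induction₂ with
    | mem_mem x y hx hy =>
      obtain ⟨p, rfl⟩ := hx
      obtain ⟨q, rfl⟩ := hy
      exact Submodule.subset_span ⟨(p.1 * q.1, p.2 * q.2), (tmul_mul_tmul _ _ _ _).symm⟩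
    | zero_left y hy => rw [zero_mul]; exact zero_mem _
    | zero_right x hx => rw [mul_zero]; exact zero_mem _
    | add_left x y z _ _ _ h₁ h₂ => rw [add_mul]; exact add_mem h₁ h₂
    | add_right x y z _ _ _ h₁ h₂ => rw [mul_add]; exact add_mem h₁ h₂
    | smul_left r x y _ _ h => rw [smul_mul_assoc]; exact Submodule.smul_mem _ r h
    | smul_right r x y _ _ h => rw [mul_smul_comm]; exact Submodule.smul_mem _ r h
  star_mem' {x} hx := by
    change star x ∈ Submodule.span ℂ (Set.range fun p : A × B => tmul p.1 p.2)
    refine Submodule.span_induction ?_ ?_ ?_ ?_ hx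
    · rintro _ ⟨p, rfl⟩
      exact Submodule.subset_span ⟨(star p.1, star p.2), (star_tmul _ _).symm⟩
    · rw [star_zero]; exact zero_mem _
    · intro f g _ _ hf hg
      rw [star_add]; exact add_mem hf hg
    · intro c f _ hf
      rw [star_smul]; exact Submodule.smul_mem _ _ hf

variable {A B}

/-- A closed subspace suffices in place of a closed ⋆-subalgebra, because the elementary tensors
already span a ⋆-subalgebra. -/
theorem eq_top_of_forall_tmul_mem {M : Submodule ℂ (MinTensor A B)}
    (hM : IsClosed (M : Set (MinTensor A B))) (h : ∀ a b, tmul a b ∈ M) : M = ⊤ := by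
  have hspan : Submodule.span ℂ (Set.range fun p : A × B => tmul p.1 p.2) ≤ M := by
    rw [Submodule.span_le]
    rintro _ ⟨p, rfl⟩
    exact h p.1 p.2
  refine eq_top_iff.2 fun x _ => ?_
  have hx : x ∈ closure (algTensor A B : Set (MinTensor A B)) := mem_of_isClosed
    (algTensor A B).topologicalClosure
    (NonUnitalStarSubalgebra.isClosed_topologicalClosure _)
    (fun a b => NonUnitalStarSubalgebra.le_topologicalClosure _
      (Submodule.subset_span ⟨(a, b), rfl⟩)) x
  exact closure_minimal hspan hM hx

theorem eq_top_of_forall_tmul_mem_of_dense {ι κ : Type*} {E : ι → Submodule ℂ A}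
    {F : κ → Submodule ℂ B} (hE : (⨆ i, E i).topologicalClosure = ⊤)
    (hF : (⨆ j, F j).topologicalClosure = ⊤) {M : Submodule ℂ (MinTensor A B)}
    (hM : IsClosed (M : Set (MinTensor A B)))
    (h : ∀ i, ∀ a ∈ E i, ∀ j, ∀ b ∈ F j, tmul a b ∈ M) : M = ⊤ := by
  let Φ : A →ₗ[ℂ] B →ₗ[ℂ] MinTensor A B :=
    LinearMap.mk₂ ℂ tmul tmul_add_left tmul_smul_left tmul_add_right tmul_smul_right
  have h₁ (i) (a : A) (ha : a ∈ E i) (b : B) : tmul a b ∈ M := by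
    have : (⨆ j, F j).topologicalClosure ≤ M.comap (Φ a) :=
      Submodule.topologicalClosure_minimal _ (iSup_le fun j b hb => h i a ha j b hb)
        (hM.preimage (continuous_tmul_comp continuous_const continuous_id))
    exact this (hF ▸ Submodule.mem_top)
  refine eq_top_of_forall_tmul_mem hM fun a b => ?_
  have : (⨆ i, E i).topologicalClosure ≤ M.comap (Φ.flip b) :=
    Submodule.topologicalClosure_minimal _ (iSup_le fun i a ha => h₁ i a ha b)
      (hM.preimage (continuous_tmul_comp continuous_id continuous_const))
  exact this (hE ▸ Submodule.mem_top)

end MinTensor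

/-! ### Actions on C⋆-algebras -/

namespace CStarAction

/-- The representation underlying an action on a C⋆-algebra. -/
noncomputable def toBanachRep {G : Type*} [Group G] [TopologicalSpace G] {A : Type*}
    [NonUnitalCStarAlgebra A] (α : CStarAction G A) : BanachRep G A where
  hom :=
    { toFun := fun s => LinearMap.mkContinuous
        { toFun := α s
          map_add' := map_add (α s)
          map_smul' := map_smul (α s) } 1
        fun a => by rw [one_mul]; exact NonUnitalStarAlgHom.norm_apply_le (α s) a
      map_one' := ContinuousLinearMap.ext fun a => by
        change α 1 a = a
        rw [map_one]; rfl
      map_mul' := fun s t => ContinuousLinearMap.ext fun a => by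
        change α (s * t) a = α s (α t a)
        rw [map_mul]; rfl }
  norm_apply_le s a := NonUnitalStarAlgHom.norm_apply_le (α s) a
  continuous_apply := α.continuous_apply

variable {G : Type*} [CommGroup G] [TopologicalSpace G]

variable [IsTopologicalGroup G]

theorem isCStarGrading_spectralSubspace [CompactSpace G] [T2Space G] {A : Type*}
    [NonUnitalCStarAlgebra A] (α : CStarAction G A) : IsCStarGrading α.spectralSubspace where
  isClosed := α.toBanachRep.isClosed_spectralSubspace
  independent := α.toBanachRep.iSupIndep_spectralSubspace
  mul_mem χ ψ a ha b hb s := by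
    rw [map_mul, ha s, hb s, smul_mul_smul_comm]
    rfl
  star_eq := by
    have key (χ : PontryaginDual G) (a : A) (ha : a ∈ α.spectralSubspace χ) :
        star a ∈ α.spectralSubspace χ⁻¹ := fun s => by
      rw [map_star, ha s, star_smul, PontryaginDual.coe_inv_apply, ← Circle.coe_inv,
        Circle.coe_inv_eq_conj]
      rfl
    intro χ
    ext a
    refine ⟨fun ha => ?_, fun ha => ?_⟩
    · simpa using key χ _ ha
    · simpa using key χ⁻¹ _ ha
  dense := α.toBanachRep.topologicalClosure_iSup_spectralSubspace

variable {A : Type u} {B : Type v} [NonUnitalCStarAlgebra A] [NonUnitalCStarAlgebra B]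

/-- In the `B` leg `s` acts through its inverse, so the eigencharacter of `b` enters inverted. -/
theorem tmul_mem_spectralSubspace_twist (α : CStarAction G A) (β : CStarAction G B)
    {χ ψ : PontryaginDual G} {a : A} {b : B} (ha : a ∈ α.spectralSubspace χ)
    (hb : b ∈ β.spectralSubspace ψ) :
    MinTensor.tmul a b ∈ (α.twist β).spectralSubspace (χ * ψ⁻¹) := fun s => by
  rw [twist_tmul, ha s, hb s⁻¹, MinTensor.tmul_smul_left, MinTensor.tmul_smul_right, smul_smul,
    PontryaginDual.coe_map_inv, ← PontryaginDual.coe_inv_apply]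
  rfl

theorem balancedTensor_eq_spectralSubspace_one (α : CStarAction G A) (β : CStarAction G B) :
    (α.balancedTensor β : Set (MinTensor A B)) = (α.twist β).spectralSubspace 1 :=
  Set.ext fun x => forall_congr' fun s => by
    rw [PontryaginDual.one_apply, Circle.coe_one, one_smul]

end CStarAction

theorem mainTheorem2 {G : Type*} [CommGroup G] [TopologicalSpace G] [IsTopologicalGroup G]
    [CompactSpace G] [T2Space G]
    {A : Type*} {B : Type*} [NonUnitalCStarAlgebra A] [NonUnitalCStarAlgebra B]
    (α : CStarAction G A) (β : CStarAction G B) :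
    IsCStarGrading α.spectralSubspace ∧ IsCStarGrading β.spectralSubspace ∧
      (α.balancedTensor β : Set (MinTensor A B)) =
        closure (Submodule.span ℂ (⋃ χ : PontryaginDual G,
          {c : MinTensor A B | ∃ a ∈ α.spectralSubspace χ, ∃ b ∈ β.spectralSubspace χ,
            c = MinTensor.tmul a b}) : Set (MinTensor A B)) := by
  have hα := α.isCStarGrading_spectralSubspace
  have hβ := β.isCStarGrading_spectralSubspace
  refine ⟨hα, hβ, ?_⟩
  rw [CStarAction.balancedTensor_eq_spectralSubspace_one]
  refine Set.Subset.antisymm (fun x hx => ?_) (closure_minimal (Submodule.span_le.2 ?_)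
    ((α.twist β).toBanachRep.isClosed_spectralSubspace 1))
  · borelize G
    let μ : Measure G := Measure.haarMeasure ⊤
    have : IsProbabilityMeasure μ := ⟨Measure.haarMeasure_self⟩
    set U := (α.twist β).toBanachRep
    set S : Set (MinTensor A B) := ⋃ χ : PontryaginDual G,
      {c | ∃ a ∈ α.spectralSubspace χ, ∃ b ∈ β.spectralSubspace χ, c = MinTensor.tmul a b} with hS
    -- averaging over `G` fixes `x` and maps all of `A ⊗ B` into the closed span of `S`
    let P : MinTensor A B →L[ℂ] MinTensor A B := U.smoothing μ (PontryaginDual.toComplex 1⁻¹)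
    have hP : (Submodule.span ℂ S).topologicalClosure.comap P.toLinearMap = ⊤ := by
      refine MinTensor.eq_top_of_forall_tmul_mem_of_dense hα.dense hβ.dense
        ((Submodule.isClosed_topologicalClosure _).preimage P.continuous) fun χ a ha ψ b hb => ?_
      have hab := CStarAction.tmul_mem_spectralSubspace_twist α β ha hb
      change P (MinTensor.tmul a b) ∈ (Submodule.span ℂ S).topologicalClosure
      by_cases h : χ * ψ⁻¹ = 1
      · rw [h] at hab
        obtain rfl := mul_inv_eq_one.1 h
        rw [show P (MinTensor.tmul a b) = _ from U.smoothing_inv_apply_of_mem μ hab]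
        exact Submodule.le_topologicalClosure _ (Submodule.subset_span
          (Set.mem_iUnion.2 ⟨χ, a, ha, b, hb, rfl⟩))
      · rw [show P (MinTensor.tmul a b) = 0 from U.smoothing_inv_apply_of_mem_of_ne μ h hab]
        exact zero_mem _
    have hPx : P x ∈ (Submodule.span ℂ S).topologicalClosure :=
      (hP ▸ Submodule.mem_top : x ∈ (Submodule.span ℂ S).topologicalClosure.comap P.toLinearMap)
    rwa [show P x = x from U.smoothing_inv_apply_of_mem μ hx] at hPx
  · refine Set.iUnion_subset fun χ => ?_
    rintro _ ⟨a, ha, b, hb, rfl⟩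
    have h := CStarAction.tmul_mem_spectralSubspace_twist α β ha hb
    rwa [mul_inv_cancel] at h
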